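/- Let $F$ be a number field, $D\in F^{*}\setminus F^{*2}$, and let $K=F(\sqrt D)$, with Galois group $G=\mathrm{Gal}(K/F)=\langle\sigma\rangle$ of order $2$. Let $E: y^2=x^3+ax+b$ with $a,b\in F$ be an elliptic curve over $F$, and let $E_D: y^2=x^3+aD^2x+bD^3$ be its quadratic $D$-twist. Put $r_F=\operatorname{rank}E(F)$ and $r_{D,F}=\operatorname{rank}E_D(F)$. Regard $E(F)$ as a subgroup of $E(K)$, let $E(F)[2]$ be the subgroup of points $P\in E(F)$ with $2P=O$, and define the subgroups of $E(K)$ $$R_D(F)=\Big\{\Big(\frac{x}{D},\frac{y}{(\sqrt D)^3}\Big):(x,y)\in E_D(F)\Big\}\cup\{O\},\qquad N_D(F)=\{P+\sigma P: P\in E(K)\}.$$ Then the group $H^1(G,E(K))$ is finite, and its order is $$\#H^1(G,E(K))=\frac{2^{r_{D,F}}\cdot\#E(F)[2]}{(E(K):E(F)+R_D(F))}=\frac{2^{r_{D,F}}\cdot\#E(F)[2]}{(N_D(F):2E(F))}=2^{\,r_{D,F}-r_F}\cdot(E(F):N_D(F)),$$ where all the indices are finite. -/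

import Mathlib

open scoped WeierstrassCurve.Affine

namespace QuadTwist

open WeierstrassCurve WeierstrassCurve.Affine

/-- The Weierstrass curve `y² = x³ + a x + b` over `F`. -/
def curve {F : Type*} [Field F] (a b : F) : WeierstrassCurve F := ⟨0, 0, 0, a, b⟩

/-- The quadratic `D`-twist `y² = x³ + a D² x + b D³` of `curve a b`. -/
def twist {F : Type*} [Field F] (a b D : F) : WeierstrassCurve F :=
  curve (a * D ^ 2) (b * D ^ 3)

noncomputable section

variable {F K : Type*} [Field F] [Field K] [Algebra F K] {a b D : F} {δ : K}

lemma nonsingular_curve (a b : F) (x y : K) : ((curve a b)⁄K).Nonsingular x y ↔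
    y ^ 2 = x ^ 3 + algebraMap F K a * x + algebraMap F K b ∧
      (3 * x ^ 2 + algebraMap F K a ≠ 0 ∨ 2 * y ≠ 0) := by
  rw [nonsingular_iff', equation_iff]
  simp only [curve, baseChange_a₁, baseChange_a₂, baseChange_a₃, baseChange_a₄, baseChange_a₆,
    map_zero, zero_mul, mul_zero, add_zero, zero_sub, ne_eq, neg_eq_zero]

lemma nonsingular_twist (hδ : δ ^ 2 = algebraMap F K D) (h0 : δ ≠ 0) {x y : K}
    (h : ((twist a b D)⁄K).Nonsingular x y) :
    ((curve a b)⁄K).Nonsingular (x / δ ^ 2) (y / δ ^ 3) := by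
  rw [twist, nonsingular_curve] at h
  rw [nonsingular_curve]
  simp only [map_mul, map_pow, ← hδ] at h
  refine ⟨?_, h.2.imp (fun h1 h2 ↦ h1 ?_) (fun h1 h2 ↦ h1 ?_)⟩
  · field_simp
    linear_combination h.1
  · field_simp at h2
    linear_combination h2
  · field_simp at h2
    linear_combination h2

lemma negY_curve (a b : F) (x y : K) : ((curve a b)⁄K).negY x y = -y := by
  simp [negY, curve]

lemma slope_twist [DecidableEq K] (hδ : δ ^ 2 = algebraMap F K D) (h0 : δ ≠ 0)
    (x₁ x₂ y₁ y₂ : K) :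
    ((curve a b)⁄K).slope (x₁ / δ ^ 2) (x₂ / δ ^ 2) (y₁ / δ ^ 3) (y₂ / δ ^ 3) =
      ((twist a b D)⁄K).slope x₁ x₂ y₁ y₂ / δ := by
  have e2 : x₁ / δ ^ 2 = x₂ / δ ^ 2 ↔ x₁ = x₂ := div_left_inj' (pow_ne_zero 2 h0)
  have e3 : y₁ / δ ^ 3 = -(y₂ / δ ^ 3) ↔ y₁ = -y₂ := by
    rw [← neg_div]; exact div_left_inj' (pow_ne_zero 3 h0)
  simp only [Affine.slope, twist, negY_curve, e2, e3]
  split_ifs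
  · simp
  · simp only [curve, baseChange_a₁, baseChange_a₂, baseChange_a₄, map_zero, map_mul, map_pow,
      ← hδ, zero_mul, mul_zero, add_zero, sub_zero, sub_neg_eq_add, ← two_mul]
    field_simp
  · field_simp

lemma sqrt_ne_zero (hδ : δ ^ 2 = algebraMap F K D) (hD : D ≠ 0) : δ ≠ 0 := by
  rintro rfl
  exact hD ((map_eq_zero (algebraMap F K)).1 (by rw [← hδ]; simp))

/-- The group homomorphism `φ_D : E_D(K) → E(K)`, `(x, y) ↦ (x / (√D)², y / (√D)³)`, where `δ` is
the chosen square root of `D` in `K`. -/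
def phi [DecidableEq K] (a b : F) (hδ : δ ^ 2 = algebraMap F K D) (hD : D ≠ 0) :
    ((twist a b D)⁄K).Point →+ ((curve a b)⁄K).Point where
  toFun P := match P with
    | .zero => .zero
    | .some x y h => .some (x / δ ^ 2) (y / δ ^ 3) (nonsingular_twist hδ (sqrt_ne_zero hδ hD) h)
  map_zero' := rfl
  map_add' := by
    rintro (_ | ⟨x₁, y₁, h₁⟩) (_ | ⟨x₂, y₂, h₂⟩)
    any_goals rfl
    have h0 := sqrt_ne_zero hδ hD
    have e2 : x₁ / δ ^ 2 = x₂ / δ ^ 2 ↔ x₁ = x₂ := div_left_inj' (pow_ne_zero 2 h0)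
    have e3 : y₁ / δ ^ 3 = ((curve a b)⁄K).negY (x₂ / δ ^ 2) (y₂ / δ ^ 3) ↔
        y₁ = ((twist a b D)⁄K).negY x₂ y₂ := by
      rw [twist, negY_curve, negY_curve, ← neg_div]; exact div_left_inj' (pow_ne_zero 3 h0)
    by_cases hxy : x₁ = x₂ ∧ y₁ = ((twist a b D)⁄K).negY x₂ y₂
    · rw [Point.add_of_Y_eq hxy.1 hxy.2, Point.add_of_Y_eq (e2.2 hxy.1) (e3.2 hxy.2)]
      rfl
    · rw [Point.add_some hxy, Point.add_some (by rwa [e2, e3])]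
      simp only [Point.some.injEq, slope_twist hδ h0]
      simp only [addX, addY, negAddY, negY_curve, twist]
      simp only [curve, baseChange_a₁, baseChange_a₂, map_zero, zero_mul, add_zero, sub_zero]
      constructor <;> field_simp

variable (K) in
/-- `E(F)` as a subgroup of `E(K)`. -/
def EF [DecidableEq F] [DecidableEq K] (a b : F) : AddSubgroup ((curve a b)⁄K).Point :=
  (Point.baseChange (W' := curve a b) F K).range

/-- `R_D(F) = φ_D(E_D(F))`, a subgroup of `E(K)`. -/
def R [DecidableEq F] [DecidableEq K] (a b : F) (hδ : δ ^ 2 = algebraMap F K D) (hD : D ≠ 0) :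
    AddSubgroup ((curve a b)⁄K).Point :=
  ((phi a b hδ hD).comp (Point.baseChange (W' := twist a b D) F K)).range

/-- `N_D(F)`, the image of `P ↦ P + σ P` on `E(K)`. -/
def N [DecidableEq K] (a b : F) (σ : Gal(K/F)) : AddSubgroup ((curve a b)⁄K).Point :=
  (AddMonoidHom.id _ + Point.map (W' := curve a b) (σ : K →ₐ[F] K)).range

variable (K) in
/-- The `Gal(K/F)`-module `E(K)`, with the coordinatewise Galois action. -/
def galoisRep [DecidableEq K] (a b : F) : Representation ℤ Gal(K/F) ((curve a b)⁄K).Point where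
  toFun τ := (Point.map (W' := curve a b) (τ : K →ₐ[F] K)).toIntLinearMap
  map_one' := by
    ext P
    cases P <;> rfl
  map_mul' τ τ' := by
    ext P
    cases P <;> rfl

/-- `H¹(Gal(K/F), E(K))`. -/
abbrev H1 {F : Type*} (K : Type) [Field F] [Field K] [Algebra F K] [DecidableEq K] (a b : F) :=
  groupCohomology.H1 (Rep.of (galoisRep K a b))

end

end QuadTwist

namespace QuadTwist

/-!
Put `A = E(K)`. The points fixed by `σ` form `E(F)`, and those negated by `σ` form `R_D(F)`, which
is isomorphic to `E_D(F)`. For the cyclic group `⟨σ⟩` of order two, `H¹(G, A) = A^{-σ} / (1 - σ) A`.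

The map `1 + σ` has kernel `A^{-σ}` and acts on `A^σ` as multiplication by `2`, so in the chain
`2 A^σ ≤ (1 + σ) A ≤ A^σ` the first index is `(A : A^σ + A^{-σ})`, while the total index
is `2 ^ rank A^σ * #A^σ[2]`. The same holds with `-σ` in place of `σ`. Since the index of
`A^σ + A^{-σ}` does not see the sign and `A^σ[2] = A^{-σ}[2]`, comparing the two chains gives all
three formulas.

The only arithmetic input is that `E(F)` and `E_D(F)` are finitely generated. Over a field where
the cubic splits, `P ↦ (x(P) - e i)` takes values in a finite Selmer group and detects
divisibility by `2`; descent along the naive height then gives Mordell–Weil.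
-/

open WeierstrassCurve WeierstrassCurve.Affine

section FinitelyGenerated

variable {A B : Type*} [AddCommGroup A] [AddCommGroup B]

lemma card_torsionBy_congr (e : A ≃+ B) (n : ℤ) :
    Nat.card (AddSubgroup.torsionBy A n) = Nat.card (AddSubgroup.torsionBy B n) :=
  Nat.card_congr (e.toEquiv.subtypeEquiv fun a ↦ by simp [← map_zsmul])

lemma index_range_nsmul_congr (e : A ≃+ B) (n : ℕ) :
    (nsmulAddMonoidHom (α := A) n).range.index = (nsmulAddMonoidHom (α := B) n).range.index := by
  rw [← AddSubgroup.index_map_equiv _ e, AddEquiv.map_range_nsmulAddMonoidHom]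

lemma card_torsionBy_prod (n : ℤ) :
    Nat.card (AddSubgroup.torsionBy (A × B) n) =
      Nat.card (AddSubgroup.torsionBy A n) * Nat.card (AddSubgroup.torsionBy B n) := by
  rw [← Nat.card_prod, ← Nat.card_congr
    ((AddSubgroup.torsionBy A n).prodEquiv (AddSubgroup.torsionBy B n)).toEquiv]
  exact Nat.card_congr ((Equiv.refl _).subtypeEquiv fun a ↦ by
    simp [AddSubgroup.mem_prod, Prod.ext_iff])

lemma index_range_nsmul_prod (n : ℕ) :
    (nsmulAddMonoidHom (α := A × B) n).range.index =
      (nsmulAddMonoidHom (α := A) n).range.index * (nsmulAddMonoidHom (α := B) n).range.index := by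
  rw [← AddSubgroup.index_prod]
  congr 1
  ext ⟨x, y⟩
  simp [AddSubgroup.mem_prod, AddMonoidHom.mem_range, Prod.ext_iff]

lemma torsionBy_eq_bot_of_isTorsionFree [Module.IsTorsionFree ℤ A] {n : ℤ} (hn : n ≠ 0) :
    AddSubgroup.torsionBy A n = ⊥ :=
  (AddSubgroup.eq_bot_iff_forall _).2 fun _ hx ↦ (smul_eq_zero.1 hx).resolve_left hn

lemma ker_nsmulAddMonoidHom (n : ℕ) :
    (nsmulAddMonoidHom (α := A) n).ker = AddSubgroup.torsionBy A n := by
  ext x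
  simp [AddMonoidHom.mem_ker]

lemma index_range_nsmul_of_finite [Finite A] (n : ℕ) :
    (nsmulAddMonoidHom (α := A) n).range.index = Nat.card (AddSubgroup.torsionBy A n) := by
  have hrange := AddSubgroup.card_mul_index (nsmulAddMonoidHom (α := A) n).range
  have hker := AddSubgroup.card_mul_index (nsmulAddMonoidHom (α := A) n).ker
  rw [AddSubgroup.index_ker, mul_comm, ker_nsmulAddMonoidHom] at hker
  exact Nat.eq_of_mul_eq_mul_left Nat.card_pos (hrange.trans hker.symm)

lemma finrank_prod_of_finite [Finite B] :
    Module.finrank ℤ (A × B) = Module.finrank ℤ A := by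
  have htors : (LinearMap.fst ℤ A B).ker ≤ Submodule.torsion ℤ (A × B) := by
    rintro ⟨x, t⟩ (rfl : x = 0)
    refine ⟨⟨(addOrderOf t : ℤ), mem_nonZeroDivisors_of_ne_zero
      (by exact_mod_cast (addOrderOf_pos t).ne')⟩, Prod.ext (by simp) ?_⟩
    simp [Submonoid.smul_def, addOrderOf_nsmul_eq_zero]
  rw [Module.finrank, ← rank_quotient_eq_of_le_torsion htors, ← Module.finrank,
    ((LinearMap.fst ℤ A B).quotKerEquivOfSurjective Prod.fst_surjective).finrank_eq]

variable (A) in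
lemma exists_addEquiv_free_prod_finite [AddGroup.FG A] :
    ∃ (m : ℕ) (T : Type) (_ : AddCommGroup T) (_ : Finite T),
      Nonempty (A ≃+ (Fin m →₀ ℤ) × T) := by
  obtain ⟨m, ι, _, p, hp, k, ⟨e⟩⟩ := AddCommGroup.equiv_free_prod_directSum_zmod A
  have hne : ∀ i, NeZero (p i ^ k i) := fun i ↦ ⟨pow_ne_zero _ (hp i).ne_zero⟩
  classical
  exact ⟨m, _, _, inferInstance, ⟨e.trans ((AddEquiv.refl _).prodCongr
    (DirectSum.addEquivProd fun i : ι ↦ ZMod (p i ^ k i)))⟩⟩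

variable (A)

lemma card_torsionBy_ne_zero [AddGroup.FG A] (n : ℕ) [NeZero n] :
    Nat.card (AddSubgroup.torsionBy A n) ≠ 0 := by
  obtain ⟨m, T, _, _, ⟨e⟩⟩ := exists_addEquiv_free_prod_finite A
  rw [card_torsionBy_congr e, card_torsionBy_prod,
    torsionBy_eq_bot_of_isTorsionFree (by exact_mod_cast NeZero.ne n), AddSubgroup.card_bot,
    one_mul]
  exact Nat.card_pos.ne'

theorem index_range_nsmul [AddGroup.FG A] (n : ℕ) [NeZero n] :
    (nsmulAddMonoidHom (α := A) n).range.index =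
      n ^ Module.finrank ℤ A * Nat.card (AddSubgroup.torsionBy A n) := by
  obtain ⟨m, T, _, _, ⟨e⟩⟩ := exists_addEquiv_free_prod_finite A
  rw [index_range_nsmul_congr e, card_torsionBy_congr e, index_range_nsmul_prod,
    card_torsionBy_prod, AddSubgroup.index_range_nsmul, index_range_nsmul_of_finite,
    torsionBy_eq_bot_of_isTorsionFree (A := Fin m →₀ ℤ) (by exact_mod_cast NeZero.ne n),
    AddSubgroup.card_bot, one_mul, e.toIntLinearEquiv.finrank_eq, finrank_prod_of_finite]

lemma index_range_nsmul_ne_zero [AddGroup.FG A] (n : ℕ) [NeZero n] :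
    (nsmulAddMonoidHom (α := A) n).range.index ≠ 0 :=
  index_range_nsmul A n ▸
    mul_ne_zero (pow_ne_zero _ (NeZero.ne n)) (card_torsionBy_ne_zero A n)

end FinitelyGenerated

section Involution

variable {A : Type*} [AddCommGroup A]

/-- The subgroup `A^σ` of elements fixed by an endomorphism `σ`. The elements with `σ x = -x` form
`fixedSubgroup (-σ)`, so each statement below covers both kinds. -/
def fixedSubgroup (σ : A →+ A) : AddSubgroup A := σ.eqLocus (.id A)

/-- The image of the norm `1 + σ` of an endomorphism `σ`. -/
def normSubgroup (σ : A →+ A) : AddSubgroup A := (AddMonoidHom.id A + σ).range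

variable {σ : A →+ A}

lemma mem_fixedSubgroup {x : A} : x ∈ fixedSubgroup σ ↔ σ x = x := Iff.rfl

lemma mem_fixedSubgroup_neg {x : A} : x ∈ fixedSubgroup (-σ) ↔ σ x = -x :=
  neg_eq_iff_eq_neg

lemma ker_id_add : (AddMonoidHom.id A + σ).ker = fixedSubgroup (-σ) := by
  ext x
  rw [mem_fixedSubgroup_neg, AddMonoidHom.mem_ker, AddMonoidHom.add_apply, AddMonoidHom.id_apply,
    add_eq_zero_iff_eq_neg']

lemma normSubgroup_le_fixedSubgroup (hσ : ∀ x, σ (σ x) = x) :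
    normSubgroup σ ≤ fixedSubgroup σ := by
  rintro _ ⟨x, rfl⟩
  simp [mem_fixedSubgroup, hσ, add_comm]

lemma map_id_add_fixedSubgroup_sup :
    (fixedSubgroup σ ⊔ fixedSubgroup (-σ)).map (AddMonoidHom.id A + σ) =
      (fixedSubgroup σ).map (nsmulAddMonoidHom 2) := by
  rw [AddSubgroup.map_sup, (AddSubgroup.map_eq_bot_iff _).2 ker_id_add.ge, sup_bot_eq]
  refine SetLike.coe_injective (Set.image_congr fun x hx ↦ ?_)
  simp [mem_fixedSubgroup.1 hx, two_nsmul]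

lemma map_nsmul_fixedSubgroup_le_normSubgroup :
    (fixedSubgroup σ).map (nsmulAddMonoidHom 2) ≤ normSubgroup σ :=
  map_id_add_fixedSubgroup_sup (σ := σ) ▸ AddSubgroup.map_le_range _ _

theorem relIndex_normSubgroup (σ : A →+ A) :
    ((fixedSubgroup σ).map (nsmulAddMonoidHom 2)).relIndex (normSubgroup σ) =
      (fixedSubgroup σ ⊔ fixedSubgroup (-σ)).index := by
  rw [← map_id_add_fixedSubgroup_sup, normSubgroup, AddMonoidHom.range_eq_map,
    AddSubgroup.relIndex_map_map, ker_id_add, sup_assoc, sup_idem, top_sup_eq,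
    AddSubgroup.relIndex_top_right]

lemma relIndex_map_nsmul (B : AddSubgroup A) (n : ℕ) :
    (B.map (nsmulAddMonoidHom n)).relIndex B = (nsmulAddMonoidHom (α := B) n).range.index := by
  rw [AddSubgroup.relIndex, AddSubgroup.addSubgroupOf_map_nsmulAddMonoidHom_eq_range]

theorem index_sup_mul_relIndex_normSubgroup (hσ : ∀ x, σ (σ x) = x)
    [AddGroup.FG (fixedSubgroup σ)] :
    (fixedSubgroup σ ⊔ fixedSubgroup (-σ)).index * (normSubgroup σ).relIndex (fixedSubgroup σ) =
      2 ^ Module.finrank ℤ (fixedSubgroup σ) *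
        Nat.card (AddSubgroup.torsionBy (fixedSubgroup σ) 2) := by
  rw [← relIndex_normSubgroup, AddSubgroup.relIndex_mul_relIndex _ _ _
    map_nsmul_fixedSubgroup_le_normSubgroup (normSubgroup_le_fixedSubgroup hσ),
    relIndex_map_nsmul, index_range_nsmul]
  rfl

lemma map_subtype_torsionBy (B : AddSubgroup A) (n : ℤ) :
    (AddSubgroup.torsionBy B n).map B.subtype = B ⊓ AddSubgroup.torsionBy A n := by
  ext x
  simp [Subtype.ext_iff, and_comm]

lemma fixedSubgroup_neg_inf_torsionBy (σ : A →+ A) :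
    fixedSubgroup (-σ) ⊓ AddSubgroup.torsionBy A 2 =
      fixedSubgroup σ ⊓ AddSubgroup.torsionBy A 2 := by
  ext x
  rw [AddSubgroup.mem_inf, AddSubgroup.mem_inf, mem_fixedSubgroup_neg, mem_fixedSubgroup]
  refine and_congr_left fun hx : (2 : ℤ) • x = 0 ↦ ?_
  rw [two_zsmul, add_eq_zero_iff_eq_neg] at hx
  rw [← hx]

lemma card_torsionBy_fixedSubgroup_neg (σ : A →+ A) :
    Nat.card (AddSubgroup.torsionBy (fixedSubgroup (-σ)) 2) =
      Nat.card (AddSubgroup.torsionBy (fixedSubgroup σ) 2) := by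
  rw [← AddSubgroup.card_subtype, map_subtype_torsionBy, fixedSubgroup_neg_inf_torsionBy,
    ← map_subtype_torsionBy, AddSubgroup.card_subtype]

theorem index_sup_fixedSubgroup_ne_zero (hσ : ∀ x, σ (σ x) = x)
    [AddGroup.FG (fixedSubgroup σ)] :
    (fixedSubgroup σ ⊔ fixedSubgroup (-σ)).index ≠ 0 := by
  refine left_ne_zero_of_mul (b := (normSubgroup σ).relIndex (fixedSubgroup σ)) ?_
  rw [index_sup_mul_relIndex_normSubgroup hσ]
  exact mul_ne_zero (by positivity) (card_torsionBy_ne_zero _ 2)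

theorem relIndex_normSubgroup_neg_eq_div (hσ : ∀ x, σ (σ x) = x)
    [AddGroup.FG (fixedSubgroup σ)] [AddGroup.FG (fixedSubgroup (-σ))] :
    ((normSubgroup (-σ)).relIndex (fixedSubgroup (-σ)) : ℚ) =
      2 ^ Module.finrank ℤ (fixedSubgroup (-σ)) *
          Nat.card (AddSubgroup.torsionBy (fixedSubgroup σ) 2) /
        (fixedSubgroup σ ⊔ fixedSubgroup (-σ)).index := by
  rw [eq_div_iff (by exact_mod_cast index_sup_fixedSubgroup_ne_zero hσ), mul_comm]
  have h := index_sup_mul_relIndex_normSubgroup (σ := -σ) (by simpa using hσ)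
  rw [neg_neg, sup_comm, card_torsionBy_fixedSubgroup_neg] at h
  exact_mod_cast h

theorem relIndex_normSubgroup_neg_eq_mul (hσ : ∀ x, σ (σ x) = x)
    [AddGroup.FG (fixedSubgroup σ)] [AddGroup.FG (fixedSubgroup (-σ))] :
    ((normSubgroup (-σ)).relIndex (fixedSubgroup (-σ)) : ℚ) =
      2 ^ ((Module.finrank ℤ (fixedSubgroup (-σ)) : ℤ) - Module.finrank ℤ (fixedSubgroup σ)) *
        (normSubgroup σ).relIndex (fixedSubgroup σ) := by
  have hindex : ((fixedSubgroup σ ⊔ fixedSubgroup (-σ)).index : ℚ) ≠ 0 := by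
    exact_mod_cast index_sup_fixedSubgroup_ne_zero hσ
  have hcard : (Nat.card (AddSubgroup.torsionBy (fixedSubgroup σ) 2) : ℚ) =
      (fixedSubgroup σ ⊔ fixedSubgroup (-σ)).index *
        (normSubgroup σ).relIndex (fixedSubgroup σ) / 2 ^ Module.finrank ℤ (fixedSubgroup σ) := by
    rw [eq_div_iff (by positivity), mul_comm]
    exact_mod_cast (index_sup_mul_relIndex_normSubgroup hσ).symm
  rw [relIndex_normSubgroup_neg_eq_div hσ, hcard, zpow_sub₀ two_ne_zero, zpow_natCast,
    zpow_natCast]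
  field_simp

lemma relIndex_normSubgroup_ne_zero (hσ : ∀ x, σ (σ x) = x) [AddGroup.FG (fixedSubgroup σ)] :
    (normSubgroup σ).relIndex (fixedSubgroup σ) ≠ 0 := by
  refine right_ne_zero_of_mul (a := (fixedSubgroup σ ⊔ fixedSubgroup (-σ)).index) ?_
  rw [index_sup_mul_relIndex_normSubgroup hσ]
  exact mul_ne_zero (by positivity) (card_torsionBy_ne_zero _ 2)

end Involution

section Cohomology

universe u

open CategoryTheory

variable {k G : Type u} [CommRing k]

theorem card_H1_of_cyclic [Group G] [Fintype G] (A : Rep.{u} k G) {g : G}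
    (hg : ∀ x, x ∈ Subgroup.zpowers g) :
    Nat.card (groupCohomology.H1 A) =
      (LinearMap.range (A.ρ g - 1)).toAddSubgroup.relIndex
        (LinearMap.ker A.ρ.norm).toAddSubgroup := by
  have : IsCyclic G := ⟨g, hg⟩
  let _ : CommGroup G := IsCyclic.commGroup
  let S := Rep.FiniteCyclicGroup.subCompNormHom A g
  let e := (Rep.FiniteCyclicGroup.groupCohomologyIsoOdd A g hg 1 odd_one ≪≫
    S.moduleCatHomologyIso).toLinearEquiv
  have hrange : (LinearMap.range S.moduleCatToCycles).toAddSubgroup =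
      (LinearMap.range (A.ρ g - 1)).toAddSubgroup.addSubgroupOf
        (LinearMap.ker A.ρ.norm).toAddSubgroup := by
    ext x
    exact exists_congr fun y ↦ Subtype.ext_iff
  exact (Nat.card_congr e.toEquiv).trans (congrArg AddSubgroup.index hrange)

theorem card_H1_of_orderOf_eq_two [Group G] (A : Rep.{u} k G) {g : G}
    (hg : ∀ x, x ∈ Subgroup.zpowers g) (hord : orderOf g = 2) :
    Nat.card (groupCohomology.H1 A) =
      (normSubgroup (-(A.ρ g).toAddMonoidHom)).relIndex
        (fixedSubgroup (-(A.ρ g).toAddMonoidHom)) := by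
  have hcard : Nat.card G = 2 := by rw [← orderOf_eq_card_of_forall_mem_zpowers hg, hord]
  have : Finite G := Nat.finite_of_card_ne_zero (by rw [hcard]; decide)
  let _ : Fintype G := Fintype.ofFinite G
  have hnorm : A.ρ.norm = 1 + A.ρ g := by
    classical
    have huniv : (Finset.univ : Finset G) = {1, g} := by
      rw [← IsCyclic.image_range_orderOf hg, hord]
      simp [Finset.range_add_one, Finset.pair_comm]
    have hne : 1 ≠ g := by
      rintro rfl
      simp at hord
    rw [Representation.norm, huniv, Finset.sum_pair hne, map_one]
  have hrange : (LinearMap.range (A.ρ g - 1)).toAddSubgroup =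
      normSubgroup (-(A.ρ g).toAddMonoidHom) := by
    rw [← neg_sub, LinearMap.range_neg]
    ext x
    exact exists_congr fun y ↦ by simp [sub_eq_add_neg]
  have hker : (LinearMap.ker (1 + A.ρ g)).toAddSubgroup =
      fixedSubgroup (-(A.ρ g).toAddMonoidHom) :=
    ker_id_add (σ := (A.ρ g).toAddMonoidHom)
  rw [card_H1_of_cyclic A hg, hrange, hnorm, hker]

end Cohomology

section Selmer

open IsDedekindDomain FractionalIdeal nonZeroDivisors

@[to_additive]
lemma finiteIndex_of_inv_mul_mem {G α : Type*} [Group G] [Finite α] {H : Subgroup G} {T : Set G}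
    (hT : T.Finite) (f : ↥Tᶜ → α) (hf : ∀ x y, f x = f y → (x : G)⁻¹ * y ∈ H) :
    H.FiniteIndex := by
  let q : G → G ⧸ H := QuotientGroup.mk
  have hfactor : (q ∘ ((↑) : ↥Tᶜ → G)).FactorsThrough f := fun x y hxy ↦
    QuotientGroup.eq.2 (hf x y hxy)
  have hcompl : (q '' Tᶜ).Finite := by
    rw [← Subtype.range_coe (s := Tᶜ), ← Set.range_comp, ← hfactor.extend_comp (fun _ ↦ q 1),
      Set.range_comp]
    exact (Set.toFinite (Set.range f)).image _
  have : Finite (G ⧸ H) := by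
    rw [← Set.finite_univ_iff, ← Set.image_univ_of_surjective QuotientGroup.mk_surjective,
      ← Set.union_compl_self T, Set.image_union]
    exact (hT.image q).union hcompl
  exact Subgroup.finiteIndex_of_finite_quotient

lemma ker_toPrincipalIdeal {R K : Type*} [CommRing R] [IsDomain R] [Field K] [Algebra R K]
    [IsFractionRing R K] :
    (toPrincipalIdeal R K).ker = (Units.map (algebraMap R K : R →* K)).range := by
  ext x
  rw [MonoidHom.mem_ker, toPrincipalIdeal_eq_iff, Units.val_one, ← spanSingleton_one, eq_comm,
    spanSingleton_eq_spanSingleton]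
  simp [Units.ext_iff, Units.smul_def, Algebra.smul_def]

variable {R K : Type*} [CommRing R] [IsDedekindDomain R] [Field K] [Algebra R K]
  [IsFractionRing R K]

lemma exists_pow_eq_of_dvd_count {n : ℕ} (hn : n ≠ 0) (I : (FractionalIdeal R⁰ K)ˣ)
    (h : ∀ v : HeightOneSpectrum R, (n : ℤ) ∣ count K v I) :
    ∃ J : (FractionalIdeal R⁰ K)ˣ, J ^ n = I := by
  choose m hm using h
  have hm0 : ∀ᶠ v in Filter.cofinite, m v = 0 :=
    (finite_factors (I : FractionalIdeal R⁰ K)).mono fun v hv ↦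
      (mul_eq_zero.1 ((hm v).symm.trans hv)).resolve_left (by exact_mod_cast hn)
  have hfin : Function.HasFiniteMulSupport fun v : HeightOneSpectrum R ↦
      (v.asIdeal : FractionalIdeal R⁰ K) ^ m v :=
    (Filter.eventually_cofinite.1 hm0).subset fun v hv h0 ↦ hv (by simp [h0])
  have hpow : (∏ᶠ v : HeightOneSpectrum R, (v.asIdeal : FractionalIdeal R⁰ K) ^ m v) ^ n = I := by
    rw [finprod_pow hfin, ← finprod_heightOneSpectrum_factorization' K I.ne_zero]
    exact finprod_congr fun v ↦ by rw [hm, mul_comm, zpow_mul, zpow_natCast]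
  have hunit : IsUnit (∏ᶠ v : HeightOneSpectrum R, (v.asIdeal : FractionalIdeal R⁰ K) ^ m v) :=
    (isUnit_pow_iff hn).1 (hpow ▸ I.isUnit)
  exact ⟨hunit.unit, Units.ext hpow⟩

lemma valuation_eq_exp_neg_count (v : HeightOneSpectrum R) (x : Kˣ) :
    v.valuation K (x : K) = WithZero.exp (-count K v (toPrincipalIdeal R K x)) := by
  classical
  obtain ⟨r, d, hd, hx⟩ := IsFractionRing.div_surjective (A := R) (x : K)
  have hd0 : d ≠ 0 := nonZeroDivisors.ne_zero hd
  have hr0 : r ≠ 0 := by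
    rintro rfl
    exact x.ne_zero (by simp [← hx])
  have hideal : (toPrincipalIdeal R K x : FractionalIdeal R⁰ K) =
      spanSingleton R⁰ (algebraMap R K d)⁻¹ * (Ideal.span {r} : Ideal R) := by
    rw [coe_toPrincipalIdeal, coeIdeal_span_singleton, spanSingleton_mul_spanSingleton, ← hx,
      div_eq_inv_mul]
  rw [count_well_defined K v (Units.ne_zero _) hideal, ← hx, map_div₀, v.valuation_of_algebraMap,
    v.valuation_of_algebraMap, v.intValuation_if_neg hr0, v.intValuation_if_neg hd0,
    ← WithZero.exp_sub]
  congr 1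
  ring

lemma valuationOfNeZero_eq_ofAdd (v : HeightOneSpectrum R) (x : Kˣ) :
    v.valuationOfNeZero x = Multiplicative.ofAdd (-count K v (toPrincipalIdeal R K x)) := by
  rw [← WithZero.coe_inj, v.valuationOfNeZero_eq, valuation_eq_exp_neg_count]
  rfl

lemma valuationOfNeZeroMod_mk_eq_one_iff (v : HeightOneSpectrum R) (n : ℕ) (x : Kˣ) :
    v.valuationOfNeZeroMod n (x : Kˣ ⧸ (powMonoidHom n : Kˣ →* Kˣ).range) = 1 ↔
      (n : ℤ) ∣ (v.valuationOfNeZero x).toAdd :=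
  (ZMod.intCast_zmod_eq_zero_iff_dvd _ n)

variable {n : ℕ} [NeZero n]

lemma exists_pow_eq_toPrincipalIdeal (z : selmerGroup (R := R) (K := K) (S := ∅) (n := n)) :
    ∃ (x : Kˣ) (J : (FractionalIdeal R⁰ K)ˣ), QuotientGroup.mk x = z.1 ∧
      J ^ n = toPrincipalIdeal R K x := by
  obtain ⟨⟨x⟩, hx⟩ := z
  obtain ⟨J, hJ⟩ := exists_pow_eq_of_dvd_count (NeZero.ne n) (toPrincipalIdeal R K x) fun v ↦ by
    have := (valuationOfNeZeroMod_mk_eq_one_iff v n x).1 (hx v (Set.notMem_empty v))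
    rwa [valuationOfNeZero_eq_ofAdd, toAdd_ofAdd, dvd_neg] at this
  exact ⟨x, J, rfl, hJ⟩

lemma finiteIndex_range_fromUnit [Finite (ClassGroup R)] :
    (selmerGroup.fromUnit (R := R) (K := K) (n := n)).range.FiniteIndex := by
  choose x J hx hJ using exists_pow_eq_toPrincipalIdeal (R := R) (K := K) (n := n)
  have := Finite.of_equiv _ (ClassGroup.equiv (R := R) K).toEquiv
  refine finiteIndex_of_inv_mul_mem Set.finite_empty
    (fun z ↦ (J z : (FractionalIdeal R⁰ K)ˣ ⧸ (toPrincipalIdeal R K).range)) fun z w hzw ↦ ?_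
  obtain ⟨c, hc⟩ := QuotientGroup.eq.1 hzw
  have hker : (x z)⁻¹ * x w * (c ^ n)⁻¹ ∈ (toPrincipalIdeal R K).ker := by
    rw [MonoidHom.mem_ker, map_mul, map_mul, map_inv, map_inv, map_pow, hc, ← hJ, ← hJ]
    simp [mul_pow]
  obtain ⟨u, hu⟩ := ker_toPrincipalIdeal (R := R) (K := K) ▸ hker
  refine ⟨u, Subtype.ext ?_⟩
  change QuotientGroup.mk (Units.map (algebraMap R K : R →* K) u) = _
  rw [hu, Subgroup.coe_mul, Subgroup.coe_inv, ← hx, ← hx, ← QuotientGroup.mk_inv,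
    ← QuotientGroup.mk_mul, QuotientGroup.eq]
  exact ⟨c, by rw [powMonoidHom_apply]; group⟩

lemma finite_range_fromUnit [Group.FG Rˣ] :
    Finite (selmerGroup.fromUnit (R := R) (K := K) (n := n)).range := by
  have : Fact (0 < n) := ⟨NeZero.pos n⟩
  rw [← (QuotientGroup.quotientKerEquivRange _).finite_iff, selmerGroup.fromUnit_ker,
    ← Subgroup.finiteIndex_iff_finite_quotient]
  exact ⟨index_range_nsmul_ne_zero (Additive Rˣ) n⟩

theorem finite_selmerGroup [Finite (ClassGroup R)] [Group.FG Rˣ] {S : Set (HeightOneSpectrum R)}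
    (hS : S.Finite) : Finite (selmerGroup (R := R) (K := K) (S := S) (n := n)) := by
  have := hS.to_subtype
  have hempty : Finite (selmerGroup (R := R) (K := K) (S := ∅) (n := n)) :=
    (Subgroup.finite_iff_finite_and_finiteIndex _).2
      ⟨finite_range_fromUnit, finiteIndex_range_fromUnit⟩
  let val := selmerGroup.valuation (R := R) (K := K) (S := S) (n := n)
  have hker : Finite val.ker := by
    rw [selmerGroup.valuation_ker_eq]
    exact (Subgroup.subgroupOfEquivOfLe
      (selmerGroup.monotone (Set.empty_subset S))).toEquiv.finite_iff.2 hempty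
  exact (Subgroup.finite_iff_finite_and_finiteIndex val.ker).2 ⟨hker, Subgroup.finiteIndex_ker val⟩

end Selmer

section ShortWeierstrass

variable {L : Type*} [Field L] {W : Affine L} [W.IsShortNF]

lemma equation_iff_of_isShortNF {x y : L} :
    W.Equation x y ↔ y ^ 2 = x ^ 3 + W.a₄ * x + W.a₆ := by
  rw [equation_iff, a₁_of_isShortNF, a₂_of_isShortNF, a₃_of_isShortNF]
  simp only [zero_mul, add_zero]

lemma negY_of_isShortNF (x y : L) : W.negY x y = -y := by
  simp only [negY, a₁_of_isShortNF, a₃_of_isShortNF, zero_mul, sub_zero]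

lemma addX_of_isShortNF (x₁ x₂ l : L) : W.addX x₁ x₂ l = l ^ 2 - x₁ - x₂ := by
  simp only [addX, a₁_of_isShortNF, a₂_of_isShortNF, zero_mul, add_zero, sub_zero]

lemma slope_self_of_isShortNF [DecidableEq L] {x y : L} (hy : y ≠ W.negY x y) :
    W.slope x x y y = (3 * x ^ 2 + W.a₄) / (2 * y) := by
  rw [slope_of_Y_ne rfl hy, negY_of_isShortNF, a₁_of_isShortNF, a₂_of_isShortNF]
  ring

end ShortWeierstrass

section Height

open Height MvPolynomial WeierstrassCurve.Affine.Point

variable {L : Type*} [Field L] {W : Affine L}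

lemma finite_setOf_xRep_mem {s : Set (Fin 2 → L)} (hs : s.Finite) :
    {P : W.Point | P.xRep ∈ s}.Finite := by
  refine hs.preimage' (f := fun P : W.Point ↦ P.xRep) fun v _ ↦ ?_
  by_cases hv : ∃ Q : W.Point, Q.xRep = v
  · obtain ⟨Q, rfl⟩ := hv
    exact (Set.toFinite {Q, -Q}).subset fun P hP ↦ eq_or_eq_neg_of_xRep_eq_xRep hP
  · exact Set.finite_empty.subset fun P hP ↦ hv ⟨P, hP⟩

lemma northcott_logHeight_xRep [NumberField L] :
    Northcott (fun P : W.Point ↦ logHeight P.xRep) where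
  finite_le B := by
    have hfin : (insert ![1, 0] ((fun x : L ↦ ![x, 1]) '' {x | logHeight₁ x ≤ B})).Finite :=
      ((Northcott.finite_le B).image _).insert _
    refine (finite_setOf_xRep_mem (W := W) hfin).subset ?_
    rintro (_ | ⟨x, y, h⟩) hP
    · exact Or.inl rfl
    · refine Or.inr ⟨x, ?_, rfl⟩
      rw [Set.mem_ofPred_eq, logHeight₁_eq_logHeight]
      exact hP

lemma exists_abs_logHeight_sym2x_sub_le [AdmissibleAbsValues L] : ∃ C : ℝ, ∀ P Q : W.Point,
    |logHeight (P.sym2x Q) - (logHeight P.xRep + logHeight Q.xRep)| ≤ C := by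
  obtain ⟨C, hC⟩ := abs_logHeight_sym2_sub_le L
  have hrep (P : W.Point) : ![P.xRep 0, P.xRep 1] = P.xRep := List.ofFn_inj.1 rfl
  refine ⟨C, fun P Q ↦ ?_⟩
  have h := hC (by rw [hrep P]; exact xRep_ne_zero P) (by rw [hrep Q]; exact xRep_ne_zero Q)
  rwa [hrep, hrep] at h

variable [W.IsShortNF]

lemma eval_addSubMap (s t u : L) : (fun i ↦ (addSubMap W i).eval ![s, t, u]) =
    ![s ^ 2 - 2 * W.a₄ * s * u - 4 * W.a₆ * t * u + W.a₄ ^ 2 * u ^ 2,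
      2 * t * s + 2 * W.a₄ * t * u + 4 * W.a₆ * u ^ 2, t ^ 2 - 4 * s * u] := by
  ext i
  fin_cases i <;> simp [addSubMap, b₂, b₄, b₆, b₈]

lemma eval_addSubMap_zero_left (Q : W.Point) :
    (fun i ↦ (addSubMap W i).eval ((0 : W.Point).sym2x Q)) = Q.sym2x Q := by
  rcases Q with _ | ⟨x, y, h⟩
  · rw [← zero_def, sym2x_zero_zero, eval_addSubMap]
    norm_num
  · rw [sym2x_zero_some, sym2x_some_some, eval_addSubMap]
    ring_nf

variable [DecidableEq L]

lemma exists_eval_addSubMap_eq_of_X_ne {x₁ y₁ x₂ y₂ : L} (h₁ : W.Nonsingular x₁ y₁)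
    (h₂ : W.Nonsingular x₂ y₂) (hx : x₁ ≠ x₂) :
    ∃ c : L, c ≠ 0 ∧ (fun i ↦ (addSubMap W i).eval ((some _ _ h₁).sym2x (some _ _ h₂))) =
      c • (some _ _ h₁ + some _ _ h₂).sym2x (some _ _ h₁ - some _ _ h₂) := by
  have e₁ := equation_iff_of_isShortNF.1 h₁.1
  have e₂ := equation_iff_of_isShortNF.1 h₂.1
  have hx' : x₁ - x₂ ≠ 0 := sub_ne_zero.2 hx
  have ha₆ : W.a₆ = y₁ ^ 2 - x₁ ^ 3 - W.a₄ * x₁ := by linear_combination -e₁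
  have ha₄ : W.a₄ = (y₁ ^ 2 - y₂ ^ 2 - (x₁ ^ 3 - x₂ ^ 3)) / (x₁ - x₂) := by
    rw [eq_div_iff hx']
    linear_combination e₂ - e₁
  refine ⟨(x₁ - x₂) ^ 2, pow_ne_zero 2 hx', ?_⟩
  rw [sub_eq_add_neg (some _ _ h₁), neg_some, add_of_X_ne hx, add_of_X_ne hx,
    sym2x_some_some, sym2x_some_some, eval_addSubMap, slope_of_X_ne hx, slope_of_X_ne hx,
    negY_of_isShortNF, addX_of_isShortNF, addX_of_isShortNF, ha₆, ha₄, Matrix.smul_vec3]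
  simp only [smul_eq_mul, Matrix.vecCons_inj, and_true]
  refine ⟨?_, ?_, ?_⟩ <;> field_simp <;> ring

lemma exists_eval_addSubMap_self {x y : L} (h : W.Nonsingular x y) :
    ∃ c : L, c ≠ 0 ∧ (fun i ↦ (addSubMap W i).eval ((some _ _ h).sym2x (some _ _ h))) =
      c • (some _ _ h + some _ _ h).sym2x 0 := by
  have ha₆ : W.a₆ = y ^ 2 - x ^ 3 - W.a₄ * x := by
    linear_combination -equation_iff_of_isShortNF.1 h.1
  by_cases hy : y = W.negY x y
  · have h2y : 2 * y = 0 := by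
      rw [negY_of_isShortNF] at hy
      linear_combination hy
    have hderiv : 3 * x ^ 2 + W.a₄ ≠ 0 := by
      have hns := ((nonsingular_iff' ..).1 h).2
      simp only [a₁_of_isShortNF, a₂_of_isShortNF, a₃_of_isShortNF, zero_mul, mul_zero, add_zero,
        zero_sub, neg_ne_zero] at hns
      exact hns.resolve_right (not_not.2 h2y)
    refine ⟨(3 * x ^ 2 + W.a₄) ^ 2, pow_ne_zero 2 hderiv, ?_⟩
    rw [add_self_of_Y_eq hy, sym2x_zero_zero, sym2x_some_some, eval_addSubMap, ha₆,
      Matrix.smul_vec3]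
    simp only [smul_eq_mul, Matrix.vecCons_inj, and_true]
    exact ⟨by linear_combination -4 * x * y * h2y, by linear_combination 2 * y * h2y, by ring⟩
  · have h2y : 2 * y ≠ 0 := by
      rw [negY_of_isShortNF] at hy
      exact fun h0 ↦ hy (by linear_combination h0)
    refine ⟨(2 * y) ^ 2, pow_ne_zero 2 h2y, ?_⟩
    rw [add_self_of_Y_ne hy, sym2x_some_zero, sym2x_some_some, eval_addSubMap,
      slope_self_of_isShortNF hy, addX_of_isShortNF, ha₆, Matrix.smul_vec3]
    have h2 : (2 : L) ≠ 0 := left_ne_zero_of_mul h2y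
    have hy0 : y ≠ 0 := right_ne_zero_of_mul h2y
    simp only [smul_eq_mul, Matrix.vecCons_inj, and_true]
    refine ⟨?_, ?_, ?_⟩ <;> field_simp <;> ring

theorem exists_eval_addSubMap_eq (P Q : W.Point) :
    ∃ c : L, c ≠ 0 ∧ (fun i ↦ (addSubMap W i).eval (P.sym2x Q)) = c • (P + Q).sym2x (P - Q) := by
  rcases P with _ | ⟨x₁, y₁, h₁⟩
  · refine ⟨1, one_ne_zero, ?_⟩
    rw [← zero_def, zero_add, zero_sub, sym2x_neg_right, one_smul, eval_addSubMap_zero_left]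
  rcases Q with _ | ⟨x₂, y₂, h₂⟩
  · refine ⟨1, one_ne_zero, ?_⟩
    rw [← zero_def, add_zero, sub_zero, sym2x_comm, one_smul, eval_addSubMap_zero_left]
  by_cases hx : x₁ = x₂
  · rcases X_eq_iff (h₁ := h₁) (h₂ := h₂) |>.1 hx with h | h
    · rw [h, sub_self]
      exact exists_eval_addSubMap_self h₂
    · rw [h, neg_add_cancel, sym2x_neg_left, sym2x_comm 0, ← neg_add', sym2x_neg_left]
      exact exists_eval_addSubMap_self h₂
  · exact exists_eval_addSubMap_eq_of_X_ne h₁ h₂ hx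

theorem exists_abs_logHeight_xRep_add_sub_le [AdmissibleAbsValues L]
    [WeierstrassCurve.IsElliptic W] :
    ∃ C : ℝ, ∀ P Q : W.Point, |logHeight (P + Q).xRep + logHeight (P - Q).xRep -
      2 * (logHeight P.xRep + logHeight Q.xRep)| ≤ C := by
  obtain ⟨C₁, h₁⟩ := abs_logHeight_addSubMap_sub_two_mul_logHeight_le W
  obtain ⟨C₂, h₂⟩ := exists_abs_logHeight_sym2x_sub_le (W := W)
  refine ⟨C₁ + C₂ + 2 * C₂, fun P Q ↦ ?_⟩
  have hmap := h₁ (P.sym2x Q)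
  obtain ⟨c, hc, heval⟩ := exists_eval_addSubMap_eq P Q
  rw [heval, logHeight_smul_eq_logHeight _ hc] at hmap
  have hsource := h₂ P Q
  have htarget := h₂ (P + Q) (P - Q)
  rw [abs_le] at *
  constructor <;> linarith

end Height

section Valuation

variable {L Γ ι : Type*} [Field L] [LinearOrderedCommGroupWithZero Γ] [Fintype ι]

lemma isSquare_valuation_sub_of_sq_eq_prod (v : Valuation L Γ) (hι : Odd (Fintype.card ι))
    {e : ι → L} (he : ∀ i, v (e i) ≤ 1) (hsub : Pairwise fun i j ↦ v (e i - e j) = 1)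
    {x y : L} (h : y ^ 2 = ∏ i, (x - e i)) (i : ι) : IsSquare (v (x - e i)) := by
  have hv : v y ^ 2 = ∏ j, v (x - e j) := by rw [← map_pow, h, map_prod]
  rcases lt_or_ge 1 (v x) with hx | hx
  · have hpole (j : ι) : v (x - e j) = v x := v.map_sub_eq_of_lt_left ((he j).trans_lt hx)
    obtain ⟨k, hk⟩ := hι
    simp only [hpole, Finset.prod_const, Finset.card_univ, hk] at hv
    have hx0 : v x ^ k ≠ 0 := pow_ne_zero k (zero_lt_one.trans hx).ne'
    rw [hpole]
    exact ⟨v y / v x ^ k, by rw [div_mul_div_comm, eq_div_iff (mul_ne_zero hx0 hx0), ← sq, ← sq,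
      hv, ← pow_mul, mul_comm k 2, mul_comm, pow_succ]⟩
  · rcases ((v.map_sub x (e i)).trans (max_le hx (he i))).lt_or_eq with hlt | heq
    · have hone (j : ι) (hj : j ≠ i) : v (x - e j) = 1 := by
        rw [← sub_add_sub_cancel x (e i), v.map_add_eq_of_lt_right (by rwa [hsub hj.symm]),
          hsub hj.symm]
      rw [Finset.prod_eq_single i (fun j _ hj ↦ hone j hj) (by simp)] at hv
      exact ⟨v y, by rw [← hv, sq]⟩
    · exact heq ▸ IsSquare.one

end Valuation

section SelmerClass

open IsDedekindDomain HeightOneSpectrum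

variable {R L ι : Type*} [CommRing R] [IsDedekindDomain R] [Field L] [Algebra R L]
  [IsFractionRing R L]

variable (R) in
lemma exists_finite_forall_notMem_valuation_sub_eq_one [Finite ι] {e : ι → L}
    (he : Function.Injective e) : ∃ S : Set (HeightOneSpectrum R), S.Finite ∧ ∀ v ∉ S,
      (∀ i, v.valuation L (e i) ≤ 1) ∧ Pairwise fun i j ↦ v.valuation L (e i - e j) = 1 := by
  refine ⟨(⋃ i, Support R (e i)) ∪ ⋃ p : ι × ι, Support R (e p.1 - e p.2)⁻¹,
    (Set.finite_iUnion fun _ ↦ Support.finite R _).union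
      (Set.finite_iUnion fun _ ↦ Support.finite R _), fun v hv ↦ ?_⟩
  simp only [Set.mem_union, Set.mem_iUnion, not_or, not_exists, Prod.forall] at hv
  have hint (i : ι) : v.valuation L (e i) ≤ 1 := not_lt.1 (hv.1 i)
  refine ⟨hint, fun i j hij ↦ le_antisymm
    ((Valuation.map_sub _ _ _).trans (max_le (hint i) (hint j))) ?_⟩
  have hpos : 0 < v.valuation L (e i - e j) :=
    zero_lt_iff.2 ((Valuation.ne_zero_iff _).2 (sub_ne_zero.2 (he.ne hij)))
  have hinv : v.valuation L (e i - e j)⁻¹ ≤ 1 := not_lt.1 (hv.2 i j)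
  rwa [map_inv₀, inv_le_one₀ hpos] at hinv

lemma mk_mem_selmerGroup_two {S : Set (HeightOneSpectrum R)} {x : Lˣ}
    (h : ∀ v ∉ S, IsSquare (v.valuation L (x : L))) :
    QuotientGroup.mk x ∈ selmerGroup (R := R) (K := L) (S := S) (n := 2) := by
  intro v hv
  obtain ⟨r, hr⟩ := h v hv
  have hr0 : r ≠ 0 := by
    rintro rfl
    exact (Valuation.ne_zero_iff _).2 x.ne_zero (hr.trans (zero_mul 0))
  lift r to Multiplicative ℤ using hr0
  rw [← v.valuationOfNeZero_eq, ← WithZero.coe_mul, WithZero.coe_inj] at hr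
  exact (valuationOfNeZeroMod_mk_eq_one_iff v 2 x).2
    (even_iff_two_dvd.1 (even_toAdd_iff.2 ⟨r, hr⟩))

lemma isSquare_mul_of_mk_eq {u w : Lˣ}
    (h : (u : Lˣ ⧸ (powMonoidHom 2 : Lˣ →* Lˣ).range) = w) : IsSquare (u * w : L) := by
  obtain ⟨c, hc⟩ := QuotientGroup.eq.1 h
  have hw : w = u * c ^ 2 := by rw [← powMonoidHom_apply, hc, mul_inv_cancel_left]
  exact ⟨u * c, by rw [hw]; push_cast; ring⟩

end SelmerClass

section TwoDescent

open WeierstrassCurve.Affine.Point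

/-- `e 0`, `e 1` and `e 2` are the roots, with multiplicity, of the cubic `x³ + a₄ x + a₆` of a
curve in short Weierstrass form, as expressed by Vieta's formulas. -/
structure IsRootTriple {L : Type*} [CommRing L] (W : WeierstrassCurve L) (e : Fin 3 → L) :
    Prop where
  sum_eq_zero : e 0 + e 1 + e 2 = 0
  a₄_eq : W.a₄ = e 0 * e 1 + e 0 * e 2 + e 1 * e 2
  a₆_eq : W.a₆ = -(e 0 * e 1 * e 2)

variable {L : Type*} [Field L] {W : Affine L} {e : Fin 3 → L}

lemma IsRootTriple.cubic_eq_prod (he : IsRootTriple W e) (x : L) :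
    x ^ 3 + W.a₄ * x + W.a₆ = ∏ i, (x - e i) := by
  rw [he.a₄_eq, he.a₆_eq, Fin.prod_univ_three]
  linear_combination x ^ 2 * he.sum_eq_zero

variable [W.IsShortNF]

lemma IsRootTriple.sq_eq_prod (he : IsRootTriple W e) {x y : L} (h : W.Equation x y) :
    y ^ 2 = ∏ i, (x - e i) := by
  rw [← he.cubic_eq_prod]
  exact equation_iff_of_isShortNF.1 h

lemma IsRootTriple.injective (he : IsRootTriple W e) [WeierstrassCurve.IsElliptic W] :
    Function.Injective e := by
  have hΔ : W.Δ = 16 * ((e 0 - e 1) * (e 0 - e 2) * (e 1 - e 2)) ^ 2 := by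
    have h₂ : e 2 = -e 0 - e 1 := by linear_combination he.sum_eq_zero
    rw [Δ_of_isShortNF, he.a₄_eq, he.a₆_eq, h₂]
    ring
  have hne : (e 0 - e 1) * (e 0 - e 2) * (e 1 - e 2) ≠ 0 := fun h ↦
    W.isUnit_Δ.ne_zero (by rw [hΔ, h]; ring)
  simp only [mul_ne_zero_iff, sub_ne_zero] at hne
  obtain ⟨⟨h₀₁, h₀₂⟩, h₁₂⟩ := hne
  intro i j hij
  fin_cases i <;> fin_cases j <;> simp_all

variable [DecidableEq L]

lemma isSquare_prod_sub_root {r x₁ y₁ x₂ y₂ : L} (hr : r ^ 3 + W.a₄ * r + W.a₆ = 0)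
    (h₁ : W.Equation x₁ y₁) (h₂ : W.Equation x₂ y₂) (hx : x₁ ≠ x₂) :
    IsSquare ((x₁ - r) * (x₂ - r) * (W.addX x₁ x₂ (W.slope x₁ x₂ y₁ y₂) - r)) := by
  rw [equation_iff_of_isShortNF] at h₁ h₂
  have hx' : x₁ - x₂ ≠ 0 := sub_ne_zero.2 hx
  have ha₄ : W.a₄ = (y₁ ^ 2 - y₂ ^ 2 - (x₁ ^ 3 - x₂ ^ 3)) / (x₁ - x₂) := by
    rw [eq_div_iff hx']
    linear_combination h₂ - h₁
  have ha₆ : W.a₆ = y₁ ^ 2 - x₁ ^ 3 - W.a₄ * x₁ := by linear_combination -h₁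
  rw [ha₆, ha₄] at hr
  -- The square root is the value at `r` of the chord through the two points.
  refine ⟨(y₁ - y₂) / (x₁ - x₂) * (r - x₁) + y₁, ?_⟩
  rw [slope_of_X_ne hx, addX_of_isShortNF]
  field_simp at hr ⊢
  linear_combination -(x₁ - x₂) * hr

variable [NeZero (2 : L)]

lemma IsRootTriple.exists_add_self_eq (he : IsRootTriple W e) (hinj : Function.Injective e)
    {x y : L} (h : W.Nonsingular x y) {s : Fin 3 → L} (hs : ∀ i, x - e i = s i ^ 2)
    (hy : y = ∏ i, s i) : ∃ Q : W.Point, Q + Q = some x y h := by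
  have hroot (i : Fin 3) : e i = x - s i ^ 2 := by linear_combination -hs i
  have hne {i j : Fin 3} (hij : i ≠ j) : s i + s j ≠ 0 := fun h0 ↦
    hij (hinj (by rw [hroot i, hroot j]; linear_combination (s j - s i) * h0))
  have hsum := he.sum_eq_zero
  have ha₄ := he.a₄_eq
  have ha₆ := he.a₆_eq
  simp only [hroot] at hsum ha₄ ha₆
  -- The tangent at the half `(x₀, y₀)` passes through `-(x, y)`, with slope `s 0 + s 1 + s 2`.
  set x₀ := x + s 0 * s 1 + s 0 * s 2 + s 1 * s 2 with hx₀
  set y₀ := (s 0 + s 1) * (s 0 + s 2) * (s 1 + s 2) with hy₀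
  have h2y : 2 * y₀ ≠ 0 := mul_ne_zero two_ne_zero
    (mul_ne_zero (mul_ne_zero (hne (by decide)) (hne (by decide))) (hne (by decide)))
  have hY : y₀ ≠ W.negY x₀ y₀ := by
    rw [negY_of_isShortNF]
    exact fun h ↦ h2y (by linear_combination h)
  have hns : W.Nonsingular x₀ y₀ := by
    refine (nonsingular_iff ..).2 ⟨equation_iff_of_isShortNF.2 ?_, Or.inr hY⟩
    rw [ha₄, ha₆, hx₀, hy₀]
    linear_combination -(x + s 0 * s 1 + s 0 * s 2 + s 1 * s 2) ^ 2 * hsum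
  have hslope : W.slope x₀ x₀ y₀ y₀ = s 0 + s 1 + s 2 := by
    rw [slope_self_of_isShortNF hY, div_eq_iff h2y, ha₄, hx₀, hy₀]
    linear_combination 2 * (x + s 0 * s 1 + s 0 * s 2 + s 1 * s 2) * hsum
  have haddX : W.addX x₀ x₀ (W.slope x₀ x₀ y₀ y₀) = x := by
    rw [addX_of_isShortNF, hslope, hx₀]
    linear_combination -hsum
  refine ⟨some x₀ y₀ hns, ?_⟩
  rw [add_self_of_Y_ne hY, some.injEq, addY, negAddY, haddX, negY_of_isShortNF, hslope, hy,
    Fin.prod_univ_three]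
  exact ⟨rfl, by rw [hx₀, hy₀]; ring⟩

lemma IsRootTriple.exists_add_self_eq_of_isSquare (he : IsRootTriple W e)
    (hinj : Function.Injective e) {x y : L} (h : W.Nonsingular x y)
    (hsq : ∀ i, IsSquare (x - e i)) : ∃ Q : W.Point, Q + Q = some x y h := by
  choose s hs using fun i ↦ (isSquare_iff_exists_sq _).1 (hsq i)
  have hy := he.sq_eq_prod h.1
  simp only [hs, Finset.prod_pow, sq_eq_sq_iff_eq_or_eq_neg] at hy
  rcases hy with hy | hy
  · exact he.exists_add_self_eq hinj h hs hy
  · refine he.exists_add_self_eq hinj h (s := -s) (fun i ↦ by rw [hs, Pi.neg_apply, neg_sq]) ?_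
    simp only [hy, Fin.prod_univ_three, Pi.neg_apply]
    ring

lemma IsRootTriple.neg_add_mem_range_two_nsmul (he : IsRootTriple W e)
    (hinj : Function.Injective e) {x₁ y₁ x₂ y₂ : L} (h₁ : W.Nonsingular x₁ y₁)
    (h₂ : W.Nonsingular x₂ y₂) (hx₁ : ∀ i, x₁ ≠ e i) (hx₂ : ∀ i, x₂ ≠ e i)
    (hsq : ∀ i, IsSquare ((x₁ - e i) * (x₂ - e i))) :
    -some x₁ y₁ h₁ + some x₂ y₂ h₂ ∈ (nsmulAddMonoidHom (α := W.Point) 2).range := by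
  by_cases hx : x₁ = x₂
  · rcases X_eq_iff (h₁ := h₁) (h₂ := h₂) |>.1 hx with h | h
    · rw [h, neg_add_cancel]
      exact zero_mem _
    · rw [h, neg_neg, ← two_nsmul]
      exact ⟨_, rfl⟩
  have hsum (i : Fin 3) : IsSquare (W.addX x₁ x₂ (W.slope x₁ x₂ y₁ y₂) - e i) := by
    have hroot : e i ^ 3 + W.a₄ * e i + W.a₆ = 0 :=
      (he.cubic_eq_prod _).trans (Finset.prod_eq_zero (Finset.mem_univ i) (sub_self _))
    have hdiv := (isSquare_prod_sub_root hroot h₁.1 h₂.1 hx).div (hsq i)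
    rwa [mul_div_cancel_left₀ _
      (mul_ne_zero (sub_ne_zero.2 (hx₁ i)) (sub_ne_zero.2 (hx₂ i)))] at hdiv
  obtain ⟨Q, hQ⟩ := he.exists_add_self_eq_of_isSquare hinj
    (nonsingular_add h₁ h₂ fun h ↦ hx h.1) hsum
  rw [← add_of_X_ne (h₁ := h₁) (h₂ := h₂) hx] at hQ
  refine ⟨Q - some x₁ y₁ h₁, ?_⟩
  rw [nsmulAddMonoidHom_apply, nsmul_sub, two_nsmul, hQ, two_nsmul]
  abel

end TwoDescent

section WeakMordellWeil

open IsDedekindDomain WeierstrassCurve.Affine.Point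

variable {L : Type*} [Field L] {W : Affine L}

lemma finite_setOf_X_eq {ι : Type*} [Finite ι] (e : ι → L) :
    {P : W.Point | ∀ x y h, P = some x y h → ∃ i, x = e i}.Finite := by
  have hfin : (insert ![1, 0] (Set.range fun i ↦ ![e i, 1])).Finite :=
    (Set.finite_range _).insert _
  refine (finite_setOf_xRep_mem hfin).subset ?_
  rintro (_ | ⟨x, y, h⟩) hP
  · exact Or.inl rfl
  · obtain ⟨i, rfl⟩ := hP x y h rfl
    exact Or.inr ⟨i, rfl⟩

theorem IsRootTriple.finiteIndex_range_two_nsmul [W.IsShortNF] [DecidableEq L] [NeZero (2 : L)]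
    (R : Type*) [CommRing R] [IsDedekindDomain R] [Algebra R L] [IsFractionRing R L]
    [Finite (ClassGroup R)] [Group.FG Rˣ] {e : Fin 3 → L} (he : IsRootTriple W e)
    (hinj : Function.Injective e) : (nsmulAddMonoidHom (α := W.Point) 2).range.FiniteIndex := by
  obtain ⟨S, hS, hgood⟩ := exists_finite_forall_notMem_valuation_sub_eq_one R hinj
  have := finite_selmerGroup (K := L) (n := 2) hS
  let T : Set W.Point := {P | ∀ x y h, P = some x y h → ∃ i, x = e i}
  have haffine (P : ↥Tᶜ) : ∃ x y h, (P : W.Point) = some x y h ∧ ∀ i, x ≠ e i := by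
    by_contra! hcon
    exact P.2 hcon
  choose x y h hP hx using haffine
  let u (P : ↥Tᶜ) (i : Fin 3) : Lˣ := Units.mk0 (x P - e i) (sub_ne_zero.2 (hx P i))
  have hu (P : ↥Tᶜ) (i : Fin 3) : QuotientGroup.mk (u P i) ∈
      selmerGroup (R := R) (K := L) (S := S) (n := 2) :=
    mk_mem_selmerGroup_two fun v hv ↦ isSquare_valuation_sub_of_sq_eq_prod _ (by decide)
      (hgood v hv).1 (hgood v hv).2 (he.sq_eq_prod (h P).1) i
  refine finiteIndex_of_neg_add_mem (finite_setOf_X_eq e)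
    (fun P i ↦ (⟨_, hu P i⟩ : selmerGroup (R := R) (K := L) (S := S) (n := 2)))
    fun P Q hPQ ↦ ?_
  rw [hP, hP]
  exact he.neg_add_mem_range_two_nsmul hinj _ _ (hx P) (hx Q) fun i ↦
    isSquare_mul_of_mk_eq (congrArg Subtype.val (congrFun hPQ i))

end WeakMordellWeil

section MordellWeil

open NumberField Polynomial

instance isShortNF_baseChange {F : Type*} [CommRing F] (A : Type*) [CommRing A] [Algebra F A]
    (E : WeierstrassCurve F) [E.IsShortNF] : (E⁄A).IsShortNF where
  a₁ := by rw [baseChange_a₁, a₁_of_isShortNF, map_zero]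
  a₂ := by rw [baseChange_a₂, a₂_of_isShortNF, map_zero]
  a₃ := by rw [baseChange_a₃, a₃_of_isShortNF, map_zero]

instance isShortNF_curve {F : Type*} [Field F] (a b : F) : (curve a b).IsShortNF :=
  ⟨rfl, rfl, rfl⟩

instance isShortNF_twist {F : Type*} [Field F] (a b D : F) : (twist a b D).IsShortNF :=
  isShortNF_curve _ _

lemma isElliptic_twist {F : Type*} [Field F] (a b : F) {D : F} (hD : D ≠ 0)
    [(curve a b).IsElliptic] : (twist a b D).IsElliptic := by
  have hΔ : (twist a b D).Δ = D ^ 6 * (curve a b).Δ := by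
    rw [Δ_of_isShortNF, Δ_of_isShortNF]
    simp only [twist, curve]
    ring
  exact ⟨hΔ ▸ (hD.isUnit.pow 6).mul (curve a b).isUnit_Δ⟩

lemma exists_isRootTriple_baseChange {F : Type*} [Field F] (E : WeierstrassCurve F) {L : Type*}
    [Field L] [Algebra F L]
    (hL : ((⟨1, 0, E.a₄, E.a₆⟩ : Cubic F).toPoly.map (algebraMap F L)).Splits) :
    ∃ e, IsRootTriple (E⁄L) e := by
  obtain ⟨e₀, e₁, e₂, h⟩ := (Cubic.splits_iff_roots_eq_three one_ne_zero).1 hL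
  have hsum := Cubic.b_eq_three_roots one_ne_zero h
  have ha₄ := Cubic.c_eq_three_roots one_ne_zero h
  have ha₆ := Cubic.d_eq_three_roots one_ne_zero h
  simp only [map_one, map_zero, one_mul] at hsum ha₄ ha₆
  exact ⟨![e₀, e₁, e₂], neg_eq_zero.1 hsum.symm, ha₄, ha₆⟩

theorem IsRootTriple.fg_point {L : Type*} [Field L] [NumberField L] [DecidableEq L]
    {W : WeierstrassCurve L} [W.IsShortNF] [W.IsElliptic] {e : Fin 3 → L}
    (he : IsRootTriple W e) : AddGroup.FG W.toAffine.Point := by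
  have : Group.FG (𝓞 L)ˣ := Group.fg_iff_monoid_fg.2 (inferInstanceAs (Monoid.FG (𝓞 L)ˣ))
  obtain ⟨C, hC⟩ := exists_abs_logHeight_xRep_add_sub_le (W := W.toAffine)
  have := northcott_logHeight_xRep (W := W.toAffine)
  exact AddCommGroup.fg_of_descent'
    (IsRootTriple.finiteIndex_range_two_nsmul (W := W.toAffine) (𝓞 L) he he.injective)
    (fun _ ↦ Height.logHeight_nonneg _) hC

instance fg_point {F : Type*} [Field F] [NumberField F] [DecidableEq F] (E : WeierstrassCurve F)
    [E.IsShortNF] [E.IsElliptic] : AddGroup.FG (E⁄F).Point := by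
  classical
  let L := (⟨1, 0, E.a₄, E.a₆⟩ : Cubic F).toPoly.SplittingField
  have : NumberField L := NumberField.of_module_finite F L
  obtain ⟨e, he⟩ := exists_isRootTriple_baseChange E (L := L) (SplittingField.splits _)
  have : (E⁄L).IsElliptic := inferInstanceAs (E.map (algebraMap F L)).IsElliptic
  have : Module.Finite ℤ (E⁄L).Point := Module.Finite.iff_addGroup_fg.2 he.fg_point
  exact Module.Finite.iff_addGroup_fg.1 (Module.Finite.of_injective
    (Point.baseChange (W' := E) F L).toIntLinearMap (Point.map_injective _))

end MordellWeil

section QuadraticExtension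

variable {F K : Type*} [Field F] [Field K] [Algebra F K] {D : F} {δ : K} {σ : Gal(K/F)}

open Polynomial in
lemma finrank_eq_two_of_adjoin_sqrt (hDsq : ¬ IsSquare D) (hδ : δ ^ 2 = algebraMap F K D)
    (hK : IntermediateField.adjoin F {δ} = ⊤) : Module.finrank F K = 2 := by
  have hmonic : (X ^ 2 - C D : F[X]).Monic := monic_X_pow_sub_C D two_ne_zero
  have hroot : aeval δ (X ^ 2 - C D : F[X]) = 0 := by simp [hδ]
  have hirr : Irreducible (X ^ 2 - C D : F[X]) :=
    X_pow_sub_C_irreducible_of_prime Nat.prime_two fun d hd ↦ hDsq ⟨d, by rw [← hd, sq]⟩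
  rw [← IntermediateField.finrank_top', ← hK,
    IntermediateField.adjoin.finrank ⟨_, hmonic, by rwa [← aeval_def]⟩,
    ← minpoly.eq_of_irreducible_of_monic hirr hroot hmonic, natDegree_X_pow_sub_C]

lemma isGalois_of_adjoin_sqrt [NeZero (2 : F)] (hrank : Module.finrank F K = 2)
    (hδ : δ ^ 2 = algebraMap F K D) (hK : IntermediateField.adjoin F {δ} = ⊤) : IsGalois F K := by
  have : FiniteDimensional F K := Module.finite_of_finrank_eq_succ hrank
  have hprim : (primitiveRoots (Module.finrank F K) F).Nonempty := by
    have hchar : ringChar F ≠ 2 := fun h ↦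
      two_ne_zero (α := F) (by exact_mod_cast h ▸ ringChar.Nat.cast_ringChar (R := F))
    rw [hrank]
    exact ⟨-1, (mem_primitiveRoots two_pos).2 (IsPrimitiveRoot.neg_one (ringChar F) hchar)⟩
  have hroot : ∃ α : K, α ^ Module.finrank F K ∈ Set.range (algebraMap F K) ∧
      IntermediateField.adjoin F {α} = ⊤ := ⟨δ, ⟨D, by rw [hrank, hδ]⟩, hK⟩
  obtain ⟨hgal, -⟩ : IsGalois F K ∧ IsCyclic Gal(K/F) :=
    ((isCyclic_tfae F K hprim).out 0 2).2 hroot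
  exact hgal

lemma mem_range_algebraMap_iff_of_zpowers_eq_top [FiniteDimensional F K] [IsGalois F K]
    (hσ : Subgroup.zpowers σ = ⊤) (x : K) : x ∈ Set.range (algebraMap F K) ↔ σ x = x := by
  rw [IsGalois.mem_range_algebraMap_iff_fixed]
  refine ⟨fun h ↦ h σ, fun h τ ↦ ?_⟩
  have hle : Subgroup.zpowers σ ≤ MulAction.stabilizer Gal(K/F) x := by
    rwa [Subgroup.zpowers_le]
  exact hle (hσ ▸ Subgroup.mem_top τ)

lemma map_sqrt_eq_neg (hDsq : ¬ IsSquare D) (hδ : δ ^ 2 = algebraMap F K D)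
    (hfix : ∀ x : K, x ∈ Set.range (algebraMap F K) ↔ σ x = x) : σ δ = -δ := by
  have hsq : (σ δ) ^ 2 = δ ^ 2 := by rw [← map_pow, hδ, AlgEquiv.commutes]
  refine (sq_eq_sq_iff_eq_or_eq_neg.1 hsq).resolve_left fun hσδ ↦ hDsq ?_
  obtain ⟨d, rfl⟩ := (hfix δ).2 hσδ
  exact ⟨d, (algebraMap F K).injective (by rw [← hδ, map_mul, sq])⟩

end QuadraticExtension

section Points

variable {F K : Type*} [Field F] [Field K] [Algebra F K] [DecidableEq K]
  {a b D : F} {δ : K} {σ : Gal(K/F)}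

lemma phi_bijective (hδ : δ ^ 2 = algebraMap F K D) (hD : D ≠ 0) :
    Function.Bijective (phi a b hδ hD) := by
  have h0 := sqrt_ne_zero hδ hD
  refine ⟨(injective_iff_map_eq_zero _).2 ?_, ?_⟩
  · rintro (_ | ⟨x, y, h⟩) hP
    · rfl
    · exact absurd hP (Point.some_ne_zero _)
  · rintro (_ | ⟨x, y, h⟩)
    · exact ⟨0, rfl⟩
    · have hns : ((twist a b D)⁄K).Nonsingular (x * δ ^ 2) (y * δ ^ 3) := by
        rw [nonsingular_curve] at h
        rw [twist, nonsingular_curve]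
        simp only [map_mul, map_pow, ← hδ]
        refine ⟨by linear_combination δ ^ 6 * h.1, h.2.imp (fun h1 h2 ↦ h1 ?_) fun h1 h2 ↦ h1 ?_⟩
        · refine (mul_eq_zero.1 ?_).resolve_left (pow_ne_zero 4 h0)
          linear_combination h2
        · refine (mul_eq_zero.1 ?_).resolve_left (pow_ne_zero 3 h0)
          linear_combination h2
      exact ⟨.some _ _ hns, (Point.some.injEq ..).mpr
        ⟨mul_div_cancel_right₀ x (pow_ne_zero 2 h0), mul_div_cancel_right₀ y (pow_ne_zero 3 h0)⟩⟩

lemma map_phi (hδ : δ ^ 2 = algebraMap F K D) (hD : D ≠ 0) (hσδ : σ δ = -δ)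
    (P : ((twist a b D)⁄K).Point) :
    Point.map (W' := curve a b) (σ : K →ₐ[F] K) (phi a b hδ hD P) =
      -phi a b hδ hD (Point.map (W' := twist a b D) (σ : K →ₐ[F] K) P) := by
  rcases P with _ | ⟨x, y, h⟩
  · rfl
  · refine (Point.some.injEq ..).mpr ⟨?_, ?_⟩
    · change σ (x / δ ^ 2) = σ x / δ ^ 2
      rw [map_div₀, map_pow, hσδ, neg_sq]
    · rw [negY_curve]
      change σ (y / δ ^ 3) = -(σ y / δ ^ 3)
      rw [map_div₀, map_pow, hσδ, Odd.neg_pow (by decide), div_neg]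

lemma map_map_self_of_sq_eq_one (hσ : σ ^ 2 = 1) (P : ((curve a b)⁄K).Point) :
    Point.map (W' := curve a b) (σ : K →ₐ[F] K)
      (Point.map (W' := curve a b) (σ : K →ₐ[F] K) P) = P := by
  have h (x : K) : σ (σ x) = x := by rw [← AlgEquiv.mul_apply, ← sq, hσ, AlgEquiv.one_apply]
  rcases P with _ | ⟨x, y, _⟩
  · rfl
  · exact (Point.some.injEq ..).mpr ⟨h x, h y⟩

variable [DecidableEq F]

theorem EF_eq_fixedSubgroup (hfix : ∀ x : K, x ∈ Set.range (algebraMap F K) ↔ σ x = x) :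
    EF K a b = fixedSubgroup (Point.map (W' := curve a b) (σ : K →ₐ[F] K)) := by
  refine le_antisymm ?_ ?_
  · rintro _ ⟨Q, rfl⟩
    exact Point.map_baseChange _ Q
  · rintro (_ | ⟨x, y, h⟩) hP
    · exact zero_mem _
    · rw [mem_fixedSubgroup, Point.map_some, Point.some.injEq] at hP
      obtain ⟨x, rfl⟩ := (hfix x).2 hP.1
      obtain ⟨y, rfl⟩ := (hfix y).2 hP.2
      exact ⟨.some x y (((curve a b).toAffine.baseChange_nonsingular
        (Algebra.ofId F K).injective x y).1 h), rfl⟩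

theorem R_eq_fixedSubgroup_neg (hfix : ∀ x : K, x ∈ Set.range (algebraMap F K) ↔ σ x = x)
    (hδ : δ ^ 2 = algebraMap F K D) (hD : D ≠ 0) (hσδ : σ δ = -δ) :
    R a b hδ hD = fixedSubgroup (-Point.map (W' := curve a b) (σ : K →ₐ[F] K)) := by
  have hR : R a b hδ hD = (EF K (a * D ^ 2) (b * D ^ 3)).map (phi a b hδ hD) :=
    AddMonoidHom.range_comp ..
  ext P
  obtain ⟨Q, rfl⟩ := (phi_bijective hδ hD).2 P
  rw [hR, EF_eq_fixedSubgroup hfix, mem_fixedSubgroup_neg, map_phi hδ hD hσδ, neg_inj,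
    (phi_bijective hδ hD).1.eq_iff]
  exact AddSubgroup.mem_map_iff_mem (phi_bijective hδ hD).1

/-- The isomorphism of `E(F)` with the subgroup of `E(K)` fixed by `σ`. -/
noncomputable def pointEquivFixedSubgroup
    (hfix : ∀ x : K, x ∈ Set.range (algebraMap F K) ↔ σ x = x) :
    ((curve a b)⁄F).Point ≃+ fixedSubgroup (Point.map (W' := curve a b) (σ : K →ₐ[F] K)) :=
  (AddMonoidHom.ofInjective (Point.map_injective (Algebra.ofId F K))).trans
    (.addSubgroupCongr (EF_eq_fixedSubgroup hfix))

/-- The isomorphism of `E_D(F)` with the subgroup of `E(K)` negated by `σ`. -/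
noncomputable def twistPointEquivFixedSubgroupNeg
    (hfix : ∀ x : K, x ∈ Set.range (algebraMap F K) ↔ σ x = x)
    (hδ : δ ^ 2 = algebraMap F K D) (hD : D ≠ 0) (hσδ : σ δ = -δ) :
    ((twist a b D)⁄F).Point ≃+ fixedSubgroup (-Point.map (W' := curve a b) (σ : K →ₐ[F] K)) :=
  (AddMonoidHom.ofInjective (f := (phi a b hδ hD).comp (Point.baseChange F K))
    ((phi_bijective hδ hD).1.comp (Point.map_injective (Algebra.ofId F K)))).trans
    (.addSubgroupCongr (R_eq_fixedSubgroup_neg hfix hδ hD hσδ))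

end Points

theorem card_H1_eq_relIndex {F : Type*} {K : Type} [Field F] [Field K] [Algebra F K]
    [DecidableEq K] (a b : F) {σ : Gal(K/F)} (hσ : Subgroup.zpowers σ = ⊤) (hord : orderOf σ = 2) :
    Nat.card (H1 K a b) =
      (normSubgroup (-Point.map (W' := curve a b) (σ : K →ₐ[F] K))).relIndex
        (fixedSubgroup (-Point.map (W' := curve a b) (σ : K →ₐ[F] K))) :=
  card_H1_of_orderOf_eq_two (Rep.of (galoisRep K a b)) (fun τ ↦ hσ ▸ Subgroup.mem_top τ) hord

end QuadTwist

open QuadTwist WeierstrassCurve.Affine in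
theorem theorem2p5_general {F : Type*} {K : Type} [Field F] [NeZero (2 : F)] [Field K]
    [Algebra F K] [DecidableEq F] [DecidableEq K]
    (D : F) (hD : D ≠ 0) (hDsq : ¬ IsSquare D)
    (δ : K) (hδ : δ ^ 2 = algebraMap F K D) (hK : IntermediateField.adjoin F {δ} = ⊤)
    (σ : Gal(K/F)) (hσ : Subgroup.zpowers σ = ⊤)
    (a b : F) [AddGroup.FG ((curve a b)⁄F).Point]
    [AddGroup.FG ((twist a b D)⁄F).Point] :
    Finite (H1 K a b) ∧
    (Nat.card (H1 K a b) : ℚ) =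
      2 ^ Module.finrank ℤ ((twist a b D)⁄F).Point *
          Nat.card (AddSubgroup.torsionBy ((curve a b)⁄F).Point 2) /
        (EF K a b ⊔ R a b hδ hD).index ∧
    (Nat.card (H1 K a b) : ℚ) =
      2 ^ Module.finrank ℤ ((twist a b D)⁄F).Point *
          Nat.card (AddSubgroup.torsionBy ((curve a b)⁄F).Point 2) /
        ((EF K a b).map (nsmulAddMonoidHom 2)).relIndex (N a b σ) ∧
    (Nat.card (H1 K a b) : ℚ) =
      2 ^ ((Module.finrank ℤ ((twist a b D)⁄F).Point : ℤ) -
          Module.finrank ℤ ((curve a b)⁄F).Point) *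
        (N a b σ).relIndex (EF K a b) := by
  have hrank := finrank_eq_two_of_adjoin_sqrt hDsq hδ hK
  have : FiniteDimensional F K := Module.finite_of_finrank_eq_succ hrank
  have : IsGalois F K := isGalois_of_adjoin_sqrt hrank hδ hK
  have hord : orderOf σ = 2 := by
    rw [orderOf_eq_card_of_zpowers_eq_top hσ, IsGalois.card_aut_eq_finrank, hrank]
  have hfix := mem_range_algebraMap_iff_of_zpowers_eq_top hσ
  have hσδ := map_sqrt_eq_neg hDsq hδ hfix
  have hinv := map_map_self_of_sq_eq_one (a := a) (b := b) (hord ▸ pow_orderOf_eq_one σ)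
  let e := pointEquivFixedSubgroup (a := a) (b := b) hfix
  let e' := twistPointEquivFixedSubgroupNeg (a := a) (b := b) hfix hδ hD hσδ
  have := AddGroup.fg_of_surjective (f := e.toAddMonoidHom) e.surjective
  have := AddGroup.fg_of_surjective (f := e'.toAddMonoidHom) e'.surjective
  have hH1 := card_H1_eq_relIndex a b hσ hord
  have hdiv := relIndex_normSubgroup_neg_eq_div hinv
  have hN : N a b σ = normSubgroup (Point.map (W' := curve a b) (σ : K →ₐ[F] K)) := rfl
  rw [EF_eq_fixedSubgroup hfix, R_eq_fixedSubgroup_neg hfix hδ hD hσδ, hN, relIndex_normSubgroup,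
    e.toIntLinearEquiv.finrank_eq, e'.toIntLinearEquiv.finrank_eq, card_torsionBy_congr e, hH1]
  refine ⟨Nat.finite_of_card_ne_zero ?_, hdiv, hdiv, relIndex_normSubgroup_neg_eq_mul hinv⟩
  rw [hH1]
  exact relIndex_normSubgroup_ne_zero fun P ↦ by simp [hinv]

theorem theorem2p5 {F : Type*} {K : Type} [Field F] [NumberField F] [Field K] [NumberField K]
    [Algebra F K] [DecidableEq F] [DecidableEq K]
    (D : F) (hD : D ≠ 0) (hDsq : ¬ IsSquare D)
    (δ : K) (hδ : δ ^ 2 = algebraMap F K D) (hK : IntermediateField.adjoin F {δ} = ⊤)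
    (σ : Gal(K/F)) (hσ : Subgroup.zpowers σ = ⊤)
    (a b : F) [(QuadTwist.curve a b).IsElliptic] :
    Finite (QuadTwist.H1 K a b) ∧
    (Nat.card (QuadTwist.H1 K a b) : ℚ) =
      2 ^ Module.finrank ℤ ((QuadTwist.twist a b D)⁄F).Point *
          Nat.card (AddSubgroup.torsionBy ((QuadTwist.curve a b)⁄F).Point 2) /
        (QuadTwist.EF K a b ⊔ QuadTwist.R a b hδ hD).index ∧
    (Nat.card (QuadTwist.H1 K a b) : ℚ) =
      2 ^ Module.finrank ℤ ((QuadTwist.twist a b D)⁄F).Point *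
          Nat.card (AddSubgroup.torsionBy ((QuadTwist.curve a b)⁄F).Point 2) /
        ((QuadTwist.EF K a b).map (nsmulAddMonoidHom 2)).relIndex (QuadTwist.N a b σ) ∧
    (Nat.card (QuadTwist.H1 K a b) : ℚ) =
      2 ^ ((Module.finrank ℤ ((QuadTwist.twist a b D)⁄F).Point : ℤ) -
          Module.finrank ℤ ((QuadTwist.curve a b)⁄F).Point) *
        (QuadTwist.N a b σ).relIndex (QuadTwist.EF K a b) := by
  have := QuadTwist.isElliptic_twist a b hD
  exact theorem2p5_general D hD hDsq δ hδ hK σ hσ a b
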